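/- Let $k\in\mathbb N$ and let $Q\subseteq 2^{\mathbb N^k}$ be a Borel set (a Borel quantifier on $\mathbb N^k$), where subsets of $\mathbb N^k$ are identified with their characteristic functions. For a countable relational signature $\tau$, with $a(R)$ the arity of $R\in\tau$, let $X_\tau=\prod_{R\in\tau}2^{\mathbb N^{a(R)}}$, with the product topology, be the space of $\tau$-structures with universe $\mathbb N$. Let $\mathscr L_{\omega_1\omega}(Q)$ be the infinitary logic $\mathscr L_{\omega_1\omega}$ (with equality) augmented by a quantifier symbol $Q$ that binds $k$ variables $x=(x_1,\dots,x_k)$, where $Qx\,\varphi(x)$ is interpreted in structures with universe $\mathbb N$ as $\{x\in\mathbb N^k:\varphi(x)\}\in Q$. A set $A\subseteq X_\tau$ is definable in $\mathscr L_{\omega_1\omega}(Q)$ if there is a sentence $\varphi$ of $\mathscr L_{\omega_1\omega}(Q)$ in the signature $\tau$ such that $M\in A\iff M\models\varphi$ for all $M\in X_\tau$. A set $B\subseteq\mathbb N^n$ is definable in $\mathscr L_{\omega_1\omega}(Q)$ if there is a parameter-free formula $\varphi(x_0,\dots,x_{n-1})$ of $\mathscr L_{\omega_1\omega}(Q)$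 in the empty signature such that $b\in B\iff\mathbb N\models\varphi(b)$ for all $b\in\mathbb N^n$. Let $\mathrm{Aut}(Q)$ be the group of permutations $f$ of $\mathbb N$ such that $A\in Q\iff f(A)\in Q$ for all $A\subseteq\mathbb N^k$, where $f$ acts coordinatewise on tuples. A set $A\subseteq X_\tau$ is $\mathrm{Aut}(Q)$-invariant if $g(A)=A$ for all $g\in\mathrm{Aut}(Q)$, where $g(M)$ is the structure obtained from $M$ by replacing each relation by its image under $g$. Suppose that $\mathrm{Aut}(Q)$ is closed in the group $S_\infty$ of all permutations of $\mathbb N$ (with the subspace topology of $\mathbb N^{\mathbb N}$) and that for every finite tuple $a\in\mathbb N^{<\omega}$ the orbit $\{g(a):g\in\mathrm{Aut}(Q)\}$ is definable in $\mathscr L_{\omega_1\omega}(Q)$. Then for every countable relational signature $\tau$, a subset of $X_\tau$ is Borel and $\mathrm{Aut}(Q)$-invariant if and only if it is definable in $\mathscr L_{\omega_1\omega}(Q)$. -/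

import Mathlib

open scoped MeasureTheory Topology

namespace BorelQuantifier

universe u v

/-- The space `2^(ℕ^m)` of `m`-ary relations on `ℕ`, identified with their characteristic functions.
As `Bool` is discrete, it carries the usual product topology. -/
abbrev RelSpace (m : ℕ) : Type := (Fin m → ℕ) → Bool

/-- The logic space `X_τ = ∏_{R ∈ τ} 2^(ℕ^(a(R)))` of a relational signature, with the product
topology. -/
abbrev LogicSpace (L : FirstOrder.Language.{u, v}) : Type v :=
  (m : ℕ) → L.Relations m → RelSpace m

/-- The image `f(A) = {(f a₁, …, f aₘ) | a ∈ A}` of a relation `A` under a permutation `f`: the tuple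
`a` belongs to `f(A)` iff `f⁻¹ a` belongs to `A`. -/
def permRel (f : Equiv.Perm ℕ) {m : ℕ} (A : RelSpace m) : RelSpace m :=
  fun a => A (fun i => f⁻¹ (a i))

/-- The image `f(M)` of a structure `M` with universe `ℕ` under a permutation `f`. -/
def permStructure {L : FirstOrder.Language.{u, v}} (f : Equiv.Perm ℕ) (M : LogicSpace L) :
    LogicSpace L :=
  fun m R => permRel f (M m R)

/-- `Aut(Q)`: the group of permutations `f` of `ℕ` such that `A ∈ Q ↔ f(A) ∈ Q` for all
`A ⊆ ℕ^k`. -/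
def aut {k : ℕ} (Q : Set (RelSpace k)) : Subgroup (Equiv.Perm ℕ) where
  carrier := {f | ∀ A : RelSpace k, A ∈ Q ↔ permRel f A ∈ Q}
  one_mem' := fun _ => Iff.rfl
  mul_mem' := by
    intro f g hf hg A
    have h : permRel (f * g) A = permRel f (permRel g A) := by
      funext a
      simp [permRel, mul_inv_rev]
    rw [h]
    exact (hg A).trans (hf _)
  inv_mem' := by
    intro f hf A
    have h : permRel f (permRel f⁻¹ A) = A := by
      funext a
      simp [permRel]
    have h' := hf (permRel f⁻¹ A)
    rw [h] at h'
    exact h'.symm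

/-- The topology of `S_∞ = Sym(ℕ)`: the subspace topology of the Baire space `ℕ^ℕ`. -/
abbrev symTopology : TopologicalSpace (Equiv.Perm ℕ) :=
  TopologicalSpace.induced (fun f : Equiv.Perm ℕ => (f : ℕ → ℕ)) inferInstance

/-- Formulas of `L_{ω₁ω}(Q)` over a relational signature, for a quantifier symbol `Q` of type `⟨k⟩`,
with free variables among `x₀, …, x_{n-1}`. As usual in `L_{ω₁ω}`, an infinite conjunction is formed
from formulas whose free variables all lie in one finite set; countable disjunctions and `∃` are
obtained with negation. `all φ` binds the last variable of `φ` and `quant φ` its last `k`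
variables. -/
inductive QFormula (L : FirstOrder.Language.{u, v}) (k : ℕ) : ℕ → Type v
  | falsum {n : ℕ} : QFormula L k n
  | equal {n : ℕ} (i j : Fin n) : QFormula L k n
  | rel {n m : ℕ} (R : L.Relations m) (t : Fin m → Fin n) : QFormula L k n
  | neg {n : ℕ} (φ : QFormula L k n) : QFormula L k n
  | conj {n : ℕ} (φ : ℕ → QFormula L k n) : QFormula L k n
  | all {n : ℕ} (φ : QFormula L k (n + 1)) : QFormula L k n
  | quant {n : ℕ} (φ : QFormula L k (n + k)) : QFormula L k n

/-- Satisfaction `M ⊨ φ(v)` in a structure with universe `ℕ`, where the quantifier symbol has the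
fixed interpretation `Q`: the formula `Qx φ(x, v)` holds iff `{x ∈ ℕ^k | φ(x, v)} ∈ Q`. -/
def QFormula.Realize {L : FirstOrder.Language.{u, v}} {k : ℕ} (Q : Set (RelSpace k))
    (M : LogicSpace L) : {n : ℕ} → QFormula L k n → (Fin n → ℕ) → Prop
  | _, .falsum, _ => False
  | _, .equal i j, v => v i = v j
  | _, .rel R t, v => M _ R (fun i => v (t i)) = true
  | _, .neg φ, v => ¬ φ.Realize Q M v
  | _, .conj φ, v => ∀ i, (φ i).Realize Q M v
  | _, .all φ, v => ∀ x : ℕ, φ.Realize Q M (Fin.snoc v x)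
  | _, .quant φ, v => Set.boolIndicator {x : Fin k → ℕ | φ.Realize Q M (Fin.append v x)} ∈ Q

/-- A set of structures is `L_{ω₁ω}(Q)`-definable if it is the set of models of a sentence. -/
def DefinableStructures {L : FirstOrder.Language.{u, v}} {k : ℕ} (Q : Set (RelSpace k))
    (A : Set (LogicSpace L)) : Prop :=
  ∃ φ : QFormula L k 0, ∀ M : LogicSpace L, M ∈ A ↔ φ.Realize Q M Fin.elim0

/-- The set `ℕ` as a structure in the empty signature. -/
def bareNat : LogicSpace FirstOrder.Language.empty := fun _ R => R.elim

/-- A set of `n`-tuples is `L_{ω₁ω}(Q)`-definable if it is defined in `ℕ` by a formula without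
parameters in the empty signature. -/
def DefinableTuples {k : ℕ} (Q : Set (RelSpace k)) {n : ℕ} (A : Set (Fin n → ℕ)) : Prop :=
  ∃ φ : QFormula FirstOrder.Language.empty k n, ∀ a : Fin n → ℕ, a ∈ A ↔ φ.Realize Q bareNat a

/-- The orbit `{g(a) | g ∈ G}` of a finite tuple `a`. -/
def tupleOrbit (G : Subgroup (Equiv.Perm ℕ)) {n : ℕ} (a : Fin n → ℕ) : Set (Fin n → ℕ) :=
  {b | ∃ g ∈ G, b = fun i => g (a i)}

/-- A set `A` of structures is `G`-invariant if `g(A) = A` for all `g ∈ G`. -/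
def Invariant {L : FirstOrder.Language.{u, v}} (G : Subgroup (Equiv.Perm ℕ))
    (A : Set (LogicSpace L)) : Prop :=
  ∀ g ∈ G, permStructure g '' A = A

end BorelQuantifier

/-!
The implication from definability is an induction on formulas: satisfaction at a fixed assignment
is a Borel condition on the structure (at the quantifier `Q` because `Q` is Borel and `ℕ^k` is
countable), and it is preserved by every `g ∈ Aut(Q)` acting on structure and assignment.

The converse is Vaught's proof of the Lopez-Escobar theorem, relativised to `G = Aut(Q)`. As a
closed subgroup of `S_∞`, the group `G` is a Baire space, and the sets `cylinder G a` of those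
`g ∈ G` that send `(0, …, n-1)` to `a ∈ ℕ^n` form a basis. To `A ⊆ X_τ` one associates the relation
`VaughtTransform G A M a`: for comeagrely many `g ∈ cylinder G a` the structure `g⁻¹ M` lies in `A`.
The Borel sets whose transforms on all `ℕ^n` are definable form a σ-algebra: countable
intersections commute with the transform, and for complements the Baire property gives that the
transform of `Aᶜ` holds at `a` iff that of `A` fails at every extension of `a` with nonempty
cylinder (`vaughtTransform_compl_iff`). Cylinders are nonempty exactly at the points of the orbit of
`(0, …, n-1)`, so the definability of orbits is what makes this condition expressible. The
subbasic clopen sets are handled by passing to long extensions, on which `G`'s action on the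
relevant tuple is determined. Finally, for an invariant `A` the transform at the empty tuple is `A`
itself.
-/

open Filter Topology

namespace BorelQuantifier

universe u v

/-! ### Definable sets are Borel and invariant -/

theorem borel_relSpace_eq (m : ℕ) : borel (RelSpace m) = MeasurableSpace.pi :=
  (BorelSpace.measurable_eq (α := RelSpace m)).symm

theorem borel_logicSpace_eq (L : FirstOrder.Language.{u, v}) [Countable (Σ m, L.Relations m)] :
    borel (LogicSpace L) = MeasurableSpace.pi := by
  have : ∀ m, Countable (L.Relations m) := fun m =>
    (sigma_mk_injective (β := fun m => L.Relations m) (i := m)).countable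
  exact (BorelSpace.measurable_eq (α := LogicSpace L)).symm

theorem measurableSet_rel {L : FirstOrder.Language.{u, v}} {m : ℕ} (R : L.Relations m)
    (b : Fin m → ℕ) : MeasurableSet {M : LogicSpace L | M m R b = true} := by
  have h : Measurable fun M : LogicSpace L => M m R b := by fun_prop
  exact h (measurableSet_singleton true)

theorem measurableSet_realize {L : FirstOrder.Language.{u, v}} {k : ℕ} {Q : Set (RelSpace k)}
    (hQ : MeasurableSet Q) {n : ℕ} (φ : QFormula L k n) :
    ∀ v : Fin n → ℕ, MeasurableSet {M : LogicSpace L | φ.Realize Q M v} := by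
  induction φ with
  | falsum => intro v; simp [QFormula.Realize]
  | equal i j => intro v; simp [QFormula.Realize]
  | rel R t =>
    intro v
    exact measurableSet_rel R fun i => v (t i)
  | neg φ ih => intro v; exact (ih v).compl
  | conj φ ih =>
    intro v
    simp only [QFormula.Realize, Set.ofPred_forall]
    exact MeasurableSet.iInter fun i => ih i v
  | all φ ih =>
    intro v
    simp only [QFormula.Realize, Set.ofPred_forall]
    exact MeasurableSet.iInter fun x => ih _
  | quant φ ih =>
    intro v
    have h : Measurable fun M : LogicSpace L =>
        Set.boolIndicator {x : Fin k → ℕ | φ.Realize Q M (Fin.append v x)} := by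
      refine measurable_pi_lambda _ fun x => measurable_to_bool ?_
      convert ih (Fin.append v x) using 1
      ext M
      exact (Set.mem_iff_boolIndicator _ _).symm
    exact h hQ

theorem realize_permStructure {L : FirstOrder.Language.{u, v}} {k : ℕ} {Q : Set (RelSpace k)}
    {g : Equiv.Perm ℕ} (hg : g ∈ aut Q) (M : LogicSpace L) {n : ℕ} (φ : QFormula L k n) :
    ∀ v : Fin n → ℕ,
      φ.Realize Q (permStructure g M) (fun i => g (v i)) ↔ φ.Realize Q M v := by
  induction φ with
  | falsum => intro v; rfl
  | equal i j => intro v; exact g.injective.eq_iff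
  | rel R t => intro v; simp [QFormula.Realize, permStructure, permRel]
  | neg φ ih => intro v; exact not_congr (ih v)
  | conj φ ih => intro v; exact forall_congr' fun i => ih i v
  | all φ ih =>
    intro v
    refine (g.forall_congr fun x => ?_).symm
    rw [← ih]
    congr! 1
    exact Fin.comp_snoc g v x
  | quant φ ih =>
    intro v
    refine Iff.trans ?_ (hg _).symm
    simp only [QFormula.Realize]
    congr! 1
    funext x
    have h : (fun i => g (Fin.append v (fun j => g⁻¹ (x j)) i)) =
        Fin.append (fun i => g (v i)) x := by
      funext i
      refine Fin.addCases (fun i => ?_) (fun i => ?_) i <;> simp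
    rw [Bool.eq_iff_iff, permRel, ← Set.mem_iff_boolIndicator, ← Set.mem_iff_boolIndicator,
      Set.mem_ofPred_eq, Set.mem_ofPred_eq, ← ih, h]

theorem permStructure_inv_apply {L : FirstOrder.Language.{u, v}} (g : Equiv.Perm ℕ)
    (M : LogicSpace L) (m : ℕ) (R : L.Relations m) (a : Fin m → ℕ) :
    permStructure g⁻¹ M m R a = M m R (fun i => g (a i)) := by
  simp [permStructure, permRel]

theorem permStructure_inv_self {L : FirstOrder.Language.{u, v}} (g : Equiv.Perm ℕ)
    (M : LogicSpace L) : permStructure g⁻¹ (permStructure g M) = M := by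
  funext m R a
  simp [permStructure, permRel]

theorem permStructure_self_inv {L : FirstOrder.Language.{u, v}} (g : Equiv.Perm ℕ)
    (M : LogicSpace L) : permStructure g (permStructure g⁻¹ M) = M := by
  funext m R a
  simp [permStructure, permRel]

theorem DefinableStructures.invariant {L : FirstOrder.Language.{u, v}} {k : ℕ}
    {Q : Set (RelSpace k)} {A : Set (LogicSpace L)} (hA : DefinableStructures Q A) :
    Invariant (aut Q) A := by
  obtain ⟨φ, hφ⟩ := hA
  have key : ∀ g ∈ aut Q, ∀ M, permStructure g M ∈ A ↔ M ∈ A := by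
    intro g hg M
    rw [hφ, hφ, ← realize_permStructure hg M φ Fin.elim0]
    congr! 1
  intro g hg
  ext M
  constructor
  · rintro ⟨N, hN, rfl⟩
    exact (key g hg N).2 hN
  · intro hM
    exact ⟨permStructure g⁻¹ M, (key _ (inv_mem hg) M).2 hM, permStructure_self_inv g M⟩

/-! ### Definable relations between structures and tuples -/

/-- A relation between structures and `n`-tuples is `L_{ω₁ω}(Q)`-definable if it is the
satisfaction relation of a formula. -/
def DefinableRel {L : FirstOrder.Language.{u, v}} {k : ℕ} (Q : Set (RelSpace k)) (n : ℕ)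
    (S : LogicSpace L → (Fin n → ℕ) → Prop) : Prop :=
  ∃ φ : QFormula L k n, ∀ M v, φ.Realize Q M v ↔ S M v

namespace DefinableRel

variable {L : FirstOrder.Language.{u, v}} {k : ℕ} {Q : Set (RelSpace k)} {n : ℕ}
  {S T : LogicSpace L → (Fin n → ℕ) → Prop}

theorem not (h : DefinableRel Q n S) : DefinableRel Q n fun M v => ¬ S M v := by
  obtain ⟨φ, hφ⟩ := h
  exact ⟨.neg φ, fun M v => not_congr (hφ M v)⟩

theorem forall_nat {S : ℕ → LogicSpace L → (Fin n → ℕ) → Prop}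
    (h : ∀ i, DefinableRel Q n (S i)) : DefinableRel Q n fun M v => ∀ i, S i M v := by
  choose φ hφ using h
  exact ⟨.conj φ, fun M v => forall_congr' fun i => hφ i M v⟩

theorem and (hS : DefinableRel Q n S) (hT : DefinableRel Q n T) :
    DefinableRel Q n fun M v => S M v ∧ T M v := by
  obtain ⟨φ, hφ⟩ := hS
  obtain ⟨ψ, hψ⟩ := hT
  refine ⟨.conj fun i => if i = 0 then φ else ψ, fun M v => ?_⟩
  simp only [← hφ, ← hψ]
  refine ⟨fun h => ⟨by simpa using h 0, by simpa using h 1⟩, fun h i => ?_⟩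
  by_cases hi : i = 0
  · simpa [hi] using h.1
  · simpa [hi] using h.2

theorem imp (hS : DefinableRel Q n S) (hT : DefinableRel Q n T) :
    DefinableRel Q n fun M v => S M v → T M v := by
  have h := (hS.and hT.not).not
  simpa only [not_and, not_not] using h

theorem forall_snoc {S : LogicSpace L → (Fin (n + 1) → ℕ) → Prop}
    (h : DefinableRel Q (n + 1) S) :
    DefinableRel Q n fun M v => ∀ x : ℕ, S M (Fin.snoc v x) := by
  obtain ⟨φ, hφ⟩ := h
  exact ⟨.all φ, fun M v => forall_congr' fun x => hφ M _⟩

theorem forall_extension {m : ℕ} (hnm : n ≤ m) :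
    ∀ {S : LogicSpace L → (Fin m → ℕ) → Prop}, DefinableRel Q m S →
      DefinableRel Q n fun M v =>
        ∀ w : Fin m → ℕ, (∀ i : Fin n, w (i.castLE hnm) = v i) → S M w := by
  induction m, hnm using Nat.le_induction with
  | base =>
    rintro S ⟨φ, hφ⟩
    refine ⟨φ, fun M v => ?_⟩
    rw [hφ]
    refine ⟨fun h w hw => ?_, fun h => h v fun i => rfl⟩
    rwa [show w = v from funext hw]
  | succ m hm ih =>
    intro S hS
    obtain ⟨φ, hφ⟩ := ih hS.forall_snoc
    refine ⟨φ, fun M v => ?_⟩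
    rw [hφ]
    constructor
    · intro h w hw
      have := h (Fin.init w) (fun i => hw i) (w (Fin.last m))
      rwa [Fin.snoc_init_self] at this
    · intro h w hw x
      refine h _ fun i => ?_
      rw [← hw i]
      exact Fin.snoc_castSucc (α := fun _ => ℕ) x w (i.castLE hm)

end DefinableRel

/-- A formula of the empty signature, read in an arbitrary signature. -/
def QFormula.ofEmpty (L : FirstOrder.Language.{u, v}) {k : ℕ} :
    {n : ℕ} → QFormula FirstOrder.Language.empty k n → QFormula L k n
  | _, .falsum => .falsum
  | _, .equal i j => .equal i j
  | _, .rel R _ => R.elim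
  | _, .neg φ => .neg (φ.ofEmpty L)
  | _, .conj φ => .conj fun i => (φ i).ofEmpty L
  | _, .all φ => .all (φ.ofEmpty L)
  | _, .quant φ => .quant (φ.ofEmpty L)

theorem QFormula.realize_ofEmpty {L : FirstOrder.Language.{u, v}} {k : ℕ} (Q : Set (RelSpace k))
    (M : LogicSpace L) {n : ℕ} (φ : QFormula FirstOrder.Language.empty k n) :
    ∀ v : Fin n → ℕ, (φ.ofEmpty L).Realize Q M v ↔ φ.Realize Q bareNat v := by
  induction φ with
  | falsum => intro v; rfl
  | equal i j => intro v; rfl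
  | rel R t => exact R.elim
  | neg φ ih => intro v; exact not_congr (ih v)
  | conj φ ih => intro v; exact forall_congr' fun i => ih i v
  | all φ ih => intro v; exact forall_congr' fun x => ih _
  | quant φ ih => intro v; simp only [QFormula.ofEmpty, QFormula.Realize, ih]

theorem DefinableTuples.definableRel {L : FirstOrder.Language.{u, v}} {k : ℕ}
    {Q : Set (RelSpace k)} {n : ℕ} {B : Set (Fin n → ℕ)} (hB : DefinableTuples Q B) :
    DefinableRel Q n fun (_ : LogicSpace L) v => v ∈ B := by
  obtain ⟨φ, hφ⟩ := hB
  exact ⟨φ.ofEmpty L, fun M v => (φ.realize_ofEmpty Q M v).trans (hφ v).symm⟩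

/-! ### Closed permutation groups as Baire spaces -/

attribute [local instance] symTopology

theorem continuous_perm_apply (i : ℕ) : Continuous fun g : Equiv.Perm ℕ => g i :=
  (continuous_apply i).comp continuous_induced_dom

theorem continuous_perm_inv_apply (i : ℕ) : Continuous fun g : Equiv.Perm ℕ => g⁻¹ i := by
  refine continuous_discrete_rng.2 fun j => ?_
  have h : (fun g : Equiv.Perm ℕ => g⁻¹ i) ⁻¹' {j} = (fun g : Equiv.Perm ℕ => g j) ⁻¹' {i} := by
    ext g
    simp only [Set.mem_preimage, Set.mem_singleton_iff]
    rw [Equiv.Perm.inv_eq_iff_eq, eq_comm]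
  rw [h]
  exact (isOpen_discrete _).preimage (continuous_perm_apply j)

/-- Recording a permutation together with its inverse realises `S_∞` as a closed subspace of a
product of two copies of Baire space; it is not closed in Baire space itself. -/
theorem isClosedEmbedding_perm_pair :
    IsClosedEmbedding fun g : Equiv.Perm ℕ => ((g : ℕ → ℕ), ((g⁻¹ : Equiv.Perm ℕ) : ℕ → ℕ)) := by
  have hcont : Continuous fun g : Equiv.Perm ℕ =>
      ((g : ℕ → ℕ), ((g⁻¹ : Equiv.Perm ℕ) : ℕ → ℕ)) :=
    (continuous_pi continuous_perm_apply).prodMk (continuous_pi continuous_perm_inv_apply)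
  have hind : IsInducing fun g : Equiv.Perm ℕ => (g : ℕ → ℕ) := ⟨rfl⟩
  refine ⟨⟨IsInducing.of_comp hcont continuous_fst hind, ?_⟩, ?_⟩
  · intro g h hgh
    exact DFunLike.coe_injective (congrArg Prod.fst hgh)
  · have hrange : Set.range (fun g : Equiv.Perm ℕ =>
        ((g : ℕ → ℕ), ((g⁻¹ : Equiv.Perm ℕ) : ℕ → ℕ))) =
        ⋂ i : ℕ, ⋂ j : ℕ, {p : (ℕ → ℕ) × (ℕ → ℕ) | p.1 i = j ↔ p.2 j = i} := by
      ext p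
      simp only [Set.mem_range, Set.mem_iInter, Set.mem_ofPred_eq]
      constructor
      · rintro ⟨g, rfl⟩ i j
        rw [Equiv.Perm.inv_eq_iff_eq, eq_comm]
      · intro h
        refine ⟨⟨p.1, p.2, fun i => (h i _).1 rfl, fun j => (h _ j).2 rfl⟩, rfl⟩
    rw [hrange]
    refine isClosed_iInter fun i => isClosed_iInter fun j => ?_
    have hc : Continuous fun p : (ℕ → ℕ) × (ℕ → ℕ) => (p.1 i, p.2 j) := by fun_prop
    exact (isClosed_discrete {q : ℕ × ℕ | q.1 = j ↔ q.2 = i}).preimage hc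

theorem baireSpace_of_isClosed {G : Subgroup (Equiv.Perm ℕ)}
    (hG : IsClosed (G : Set (Equiv.Perm ℕ))) : BaireSpace G := by
  have := (isClosedEmbedding_perm_pair.comp hG.isClosedEmbedding_subtypeVal).polishSpace
  exact inferInstanceAs (BaireSpace (G : Set (Equiv.Perm ℕ)))

/-- The basic open set of those `g ∈ G` that send the tuple `(0, …, n-1)` to `a`. -/
def cylinder (G : Subgroup (Equiv.Perm ℕ)) {n : ℕ} (a : Fin n → ℕ) : Set G :=
  {g | ∀ i : Fin n, (g : Equiv.Perm ℕ) i = a i}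

section Cylinder

variable {G : Subgroup (Equiv.Perm ℕ)}

theorem isOpen_cylinder {n : ℕ} (a : Fin n → ℕ) : IsOpen (cylinder G a) := by
  simp only [cylinder, Set.ofPred_forall]
  exact isOpen_iInter_of_finite fun i =>
    (isOpen_discrete {a i}).preimage
      ((continuous_perm_apply (i : ℕ)).comp continuous_subtype_val)

theorem cylinder_nonempty_iff {n : ℕ} (a : Fin n → ℕ) :
    (cylinder G a).Nonempty ↔ a ∈ tupleOrbit G fun i : Fin n => (i : ℕ) := by
  constructor
  · rintro ⟨g, hg⟩
    exact ⟨g, g.2, funext fun i => (hg i).symm⟩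
  · rintro ⟨g, hg, rfl⟩
    exact ⟨⟨g, hg⟩, fun i => rfl⟩

theorem cylinder_subset_of_extends {n m : ℕ} (hnm : n ≤ m) {a : Fin n → ℕ} {b : Fin m → ℕ}
    (hab : ∀ i : Fin n, b (i.castLE hnm) = a i) : cylinder G b ⊆ cylinder G a :=
  fun _ hg i => (hg (i.castLE hnm)).trans (hab i)

theorem exists_cylinder_subset {U : Set G} (hU : IsOpen U) {g : G} (hg : g ∈ U) (n : ℕ) :
    ∃ m, n ≤ m ∧ cylinder G (fun i : Fin m => (g : Equiv.Perm ℕ) i) ⊆ U := by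
  have hind : IsInducing fun h : G => ((h : Equiv.Perm ℕ) : ℕ → ℕ) :=
    IsInducing.comp (g := fun f : Equiv.Perm ℕ => (f : ℕ → ℕ)) ⟨rfl⟩ IsInducing.subtypeVal
  obtain ⟨V, hV, rfl⟩ := hind.isOpen_iff.1 hU
  obtain ⟨I, u, hu, hsub⟩ := isOpen_pi_iff.1 hV _ hg
  refine ⟨max n (I.sup id + 1), le_max_left _ _, fun h hh => hsub fun i hi => ?_⟩
  have hlt : i < max n (I.sup id + 1) :=
    lt_max_of_lt_right (Nat.lt_succ_of_le (Finset.le_sup (f := id) hi))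
  have : (h : Equiv.Perm ℕ) i = (g : Equiv.Perm ℕ) i := hh ⟨i, hlt⟩
  change (h : Equiv.Perm ℕ) i ∈ u i
  rw [this]
  exact (hu i hi).2

end Cylinder

/-! ### The Vaught transform -/

/-- The Vaught transform of `A`, as a relation between structures and tuples: `g⁻¹(M) ∈ A` for
comeagrely many `g` in the basic open set given by `a`. It holds vacuously if that set is empty. -/
def VaughtTransform {L : FirstOrder.Language.{u, v}} (G : Subgroup (Equiv.Perm ℕ))
    (A : Set (LogicSpace L)) (M : LogicSpace L) {n : ℕ} (a : Fin n → ℕ) : Prop :=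
  ∀ᶠ g in residual G, g ∈ cylinder G a → permStructure (g : Equiv.Perm ℕ)⁻¹ M ∈ A

section Transform

variable {L : FirstOrder.Language.{u, v}} {G : Subgroup (Equiv.Perm ℕ)} {A : Set (LogicSpace L)}
  {M : LogicSpace L} {n : ℕ} {a : Fin n → ℕ}

theorem exists_mem_of_eventually_residual {X : Type*} [TopologicalSpace X] [BaireSpace X]
    {U : Set X} (hU : IsOpen U) (hne : U.Nonempty) {p : X → Prop} (h : ∀ᶠ x in residual X, p x) :
    ∃ x ∈ U, p x :=
  (dense_of_mem_residual h).inter_open_nonempty U hU hne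

theorem measurable_permStructure_inv (M : LogicSpace L) :
    Measurable[borel G] fun g : G => permStructure (g : Equiv.Perm ℕ)⁻¹ M := by
  let _ : MeasurableSpace G := borel G
  have : BorelSpace G := ⟨rfl⟩
  refine measurable_pi_lambda _ fun m => measurable_pi_lambda _ fun R =>
    measurable_pi_lambda _ fun b => Continuous.measurable ?_
  simp only [permStructure_inv_apply]
  refine (continuous_of_discreteTopology (f := M m R)).comp (continuous_pi fun i => ?_)
  exact (continuous_perm_apply (b i)).comp continuous_subtype_val

theorem vaughtTransform_iInter_iff {A : ℕ → Set (LogicSpace L)} :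
    VaughtTransform G (⋂ i, A i) M a ↔ ∀ i, VaughtTransform G (A i) M a := by
  simp only [VaughtTransform, Set.mem_iInter]
  rw [← eventually_countable_forall]
  exact eventually_congr (.of_forall fun g => ⟨fun h i hg => h hg i, fun h hg i => h i hg⟩)

/-- The transform of a complement: by the Baire property, a nonmeagre subset of `cylinder G a`
is comeagre in some smaller nonempty cylinder. -/
theorem vaughtTransform_compl_iff [BaireSpace G] (hA : MeasurableSet A) :
    VaughtTransform G Aᶜ M a ↔
      ∀ (m : ℕ) (hnm : n ≤ m) (b : Fin m → ℕ), (∀ i : Fin n, b (i.castLE hnm) = a i) →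
        (cylinder G b).Nonempty → ¬ VaughtTransform G A M b := by
  constructor
  · intro h m hnm b hab hne hb
    obtain ⟨g, hg, hgA, hgb⟩ :=
      exists_mem_of_eventually_residual (isOpen_cylinder b) hne (h.and hb)
    exact hgA (cylinder_subset_of_extends hnm hab hg) (hgb hg)
  · intro h
    let _ : MeasurableSpace G := borel G
    have : BorelSpace G := ⟨rfl⟩
    have hS : MeasurableSet (cylinder G a ∩
        (fun g : G => permStructure (g : Equiv.Perm ℕ)⁻¹ M) ⁻¹' A) :=
      (isOpen_cylinder a).measurableSet.inter (measurable_permStructure_inv M hA)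
    obtain ⟨U, hU, hSU⟩ := hS.residualEq_isOpen
    have hSU' : ∀ᶠ g in residual G,
        (g ∈ cylinder G a ∧ permStructure (g : Equiv.Perm ℕ)⁻¹ M ∈ A) ↔ g ∈ U :=
      hSU.mem_iff
    rcases U.eq_empty_or_nonempty with rfl | hne
    · filter_upwards [hSU'] with g hg hga hgA
      exact hg.1 ⟨hga, hgA⟩
    · obtain ⟨g, hgU, hg⟩ := exists_mem_of_eventually_residual hU hne hSU'
      obtain ⟨m, hnm, hsub⟩ := exists_cylinder_subset hU hgU n
      refine absurd ?_ (h m hnm (fun i => (g : Equiv.Perm ℕ) i) (fun i => (hg.2 hgU).1 i)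
        ⟨g, fun i => rfl⟩)
      filter_upwards [hSU'] with f hf hfm
      exact (hf.2 (hsub hfm)).2

/-- For the subbasic clopen set `{M | M ⊨ R(b)}` it suffices to look at extensions of `a` of a
fixed length `N` exceeding all entries of `b`, since these determine `g b`. -/
theorem vaughtTransform_rel_iff [BaireSpace G] {m : ℕ} (R : L.Relations m) (b : Fin m → ℕ) {N : ℕ}
    (hnN : n ≤ N) (hb : ∀ i, b i < N) :
    VaughtTransform G {M | M m R b = true} M a ↔
      ∀ c : Fin N → ℕ, (∀ i : Fin n, c (i.castLE hnN) = a i) → (cylinder G c).Nonempty →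
        M m R (fun i => c ⟨b i, hb i⟩) = true := by
  simp only [VaughtTransform, Set.mem_ofPred_eq, permStructure_inv_apply]
  constructor
  · intro h c hc hne
    obtain ⟨g, hgc, hg⟩ := exists_mem_of_eventually_residual (isOpen_cylinder c) hne h
    rw [← hg (cylinder_subset_of_extends hnN hc hgc)]
    congr 1
    funext i
    exact (hgc ⟨b i, hb i⟩).symm
  · exact fun h => .of_forall fun g hg =>
      h (fun i => (g : Equiv.Perm ℕ) i) (fun i => hg i) ⟨g, fun i => rfl⟩

theorem vaughtTransform_elim0_iff [BaireSpace G] (hA : Invariant G A) :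
    VaughtTransform G A M Fin.elim0 ↔ M ∈ A := by
  have key : ∀ g : G, permStructure (g : Equiv.Perm ℕ)⁻¹ M ∈ A ↔ M ∈ A := by
    intro g
    rw [← hA g g.2]
    constructor
    · intro h
      refine ⟨_, ?_, permStructure_self_inv (g : Equiv.Perm ℕ) M⟩
      rwa [hA g g.2] at h
    · rintro ⟨N, hN, rfl⟩
      rw [hA g g.2, permStructure_inv_self]
      exact hN
  simp only [VaughtTransform, key]
  constructor
  · intro h
    obtain ⟨g, -, hg⟩ := exists_mem_of_eventually_residual isOpen_univ Set.univ_nonempty h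
    exact hg fun i => i.elim0
  · exact fun h => .of_forall fun _ _ => h

end Transform

/-! ### Definability of Vaught transforms -/

section Definability

variable {L : FirstOrder.Language.{u, v}} {k : ℕ} {Q : Set (RelSpace k)}

theorem definableRel_cylinder_nonempty
    (horbit : ∀ (n : ℕ) (a : Fin n → ℕ), DefinableTuples Q (tupleOrbit (aut Q) a)) (n : ℕ) :
    DefinableRel Q n fun (_ : LogicSpace L) a => (cylinder (aut Q) a).Nonempty := by
  simp only [cylinder_nonempty_iff]
  exact (horbit n _).definableRel

/-- The relation `S m` is imposed on the extensions of all lengths `m`; lengths below `n` impose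
nothing. -/
theorem DefinableRel.forall_extension_of_all_lengths
    {S : (m : ℕ) → LogicSpace L → (Fin m → ℕ) → Prop} (h : ∀ m, DefinableRel Q m (S m)) (n : ℕ) :
    DefinableRel Q n fun M a => ∀ (m : ℕ) (hnm : n ≤ m) (b : Fin m → ℕ),
      (∀ i : Fin n, b (i.castLE hnm) = a i) → S m M b := by
  refine .forall_nat fun m => ?_
  by_cases hnm : n ≤ m
  · simpa only [hnm, forall_true_left] using (h m).forall_extension hnm
  · exact ⟨.neg .falsum, fun M v => by simp [QFormula.Realize, hnm]⟩

theorem definableRel_vaughtTransform [BaireSpace (aut Q)]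
    (horbit : ∀ (n : ℕ) (a : Fin n → ℕ), DefinableTuples Q (tupleOrbit (aut Q) a))
    {A : Set (LogicSpace L)} (hA : MeasurableSet A) (n : ℕ) :
    DefinableRel Q n fun M a => VaughtTransform (aut Q) A M a := by
  have hcompl : ∀ B : Set (LogicSpace L), MeasurableSet B →
      (∀ n, DefinableRel Q n fun M a => VaughtTransform (aut Q) B M a) →
      ∀ n, DefinableRel Q n fun M a => VaughtTransform (aut Q) Bᶜ M a := by
    intro B hB h n
    simp only [vaughtTransform_compl_iff hB]
    exact .forall_extension_of_all_lengths
      (fun m => (definableRel_cylinder_nonempty horbit m).imp (h m).not) n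
  -- The sets with definable transforms form a σ-algebra making all coordinate maps measurable.
  let 𝓜 : MeasurableSpace (LogicSpace L) :=
    { MeasurableSet' := fun B => MeasurableSet B ∧
        ∀ n, DefinableRel Q n fun M a => VaughtTransform (aut Q) B M a
      measurableSet_empty := by
        refine ⟨.empty, ?_⟩
        rw [← Set.compl_univ]
        refine hcompl _ .univ fun n => ⟨.neg .falsum, fun M v => ?_⟩
        simp [QFormula.Realize, VaughtTransform]
      measurableSet_compl := fun B hB => ⟨hB.1.compl, hcompl B hB.1 hB.2⟩
      measurableSet_iUnion := by
        intro B hB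
        refine ⟨.iUnion fun i => (hB i).1, ?_⟩
        rw [← compl_compl (⋃ i, B i), Set.compl_iUnion]
        refine hcompl _ (.iInter fun i => (hB i).1.compl) fun n => ?_
        simp only [vaughtTransform_iInter_iff]
        exact .forall_nat fun i => hcompl _ (hB i).1 (hB i).2 n }
  have hid : @Measurable _ _ 𝓜 MeasurableSpace.pi (id : LogicSpace L → LogicSpace L) := by
    refine @measurable_pi_lambda _ _ _ 𝓜 _ _ fun m => @measurable_pi_lambda _ _ _ 𝓜 _ _ fun R =>
      @measurable_pi_lambda _ _ _ 𝓜 _ _ fun b => @measurable_to_bool _ 𝓜 _ ?_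
    refine ⟨?_, fun n => ?_⟩
    · exact measurableSet_rel R b
    · have hb : ∀ i, b i < max n (Finset.univ.sup b + 1) := fun i =>
        lt_max_of_lt_right (Nat.lt_succ_of_le (Finset.le_sup (Finset.mem_univ i)))
      have h := fun M (a : Fin n → ℕ) => vaughtTransform_rel_iff (G := aut Q) (M := M) (a := a) R b
        (le_max_left n (Finset.univ.sup b + 1)) hb
      change DefinableRel Q n fun M a => VaughtTransform (aut Q) {M | M m R b = true} M a
      simp only [h]
      refine DefinableRel.forall_extension (le_max_left _ _)
        ((definableRel_cylinder_nonempty horbit _).imp ?_)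
      exact ⟨.rel R fun i => ⟨b i, hb i⟩, fun M v => Iff.rfl⟩
  exact (hid hA).2 n

end Definability

end BorelQuantifier

theorem proposition9 {k : ℕ} (Q : Set (BorelQuantifier.RelSpace k))
    (hQ : MeasurableSet[borel (BorelQuantifier.RelSpace k)] Q)
    (hclosed : IsClosed[BorelQuantifier.symTopology]
      (BorelQuantifier.aut Q : Set (Equiv.Perm ℕ)))
    (horbit : ∀ (n : ℕ) (a : Fin n → ℕ),
      BorelQuantifier.DefinableTuples Q
        (BorelQuantifier.tupleOrbit (BorelQuantifier.aut Q) a))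
    (L : FirstOrder.Language) [L.IsRelational] [Countable (Σ m, L.Relations m)]
    (A : Set (BorelQuantifier.LogicSpace L)) :
    (MeasurableSet[borel (BorelQuantifier.LogicSpace L)] A ∧
        BorelQuantifier.Invariant (BorelQuantifier.aut Q) A) ↔
      BorelQuantifier.DefinableStructures Q A := by
  rw [BorelQuantifier.borel_logicSpace_eq]
  rw [BorelQuantifier.borel_relSpace_eq] at hQ
  constructor
  · rintro ⟨hA, hinv⟩
    have := BorelQuantifier.baireSpace_of_isClosed hclosed
    obtain ⟨φ, hφ⟩ := BorelQuantifier.definableRel_vaughtTransform horbit hA 0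
    exact ⟨φ, fun M =>
      (BorelQuantifier.vaughtTransform_elim0_iff hinv).symm.trans (hφ M _).symm⟩
  · intro h
    refine ⟨?_, h.invariant⟩
    obtain ⟨φ, hφ⟩ := h
    have hAφ : A = {M | φ.Realize Q M Fin.elim0} := Set.ext hφ
    rw [hAφ]
    exact BorelQuantifier.measurableSet_realize hQ φ _
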